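/- For a finite simple graph $G$, let $s^+(G)$ (respectively $s^-(G)$) be the sum of the squares of the positive (respectively negative) eigenvalues of its adjacency matrix, counted with multiplicity. A generalised quadrangle of order $(s,t)$, $s,t\ge 1$, is an incidence structure with a nonempty set of points and a set of lines such that every line is incident with exactly $s+1$ points, every point is incident with exactly $t+1$ lines, two distinct points are incident with at most one common line, and for every point $x$ and line $\ell$ not incident with $x$ there is a unique pair $(y,m)$ of a point $y$ and a line $m$ with $x$ on $m$ and $y$ on both $m$ and $\ell$. Its collinearity graph has the points as vertices, two distinct points being adjacent if they are on a common line. Theorem. (1) There is a family of generalised quadrangles, one finite generalised quadrangle of order $(q,q^2)$ for each prime power $q$, whose collinearity graphs $G_q$, with numbers of vertices $n_q$, satisfy $n_q\to\infty$ and $$\frac{s^-(G_q)}{s^+(G_q)}=\Theta\bigl(n_q^{1/4}\bigr)\qquad\text{as } q\to\infty \text{ through the prime powers}.$$ (2) The collinearity graph of every finite generalised quadrangle of order $(s,t)$ is strongly regular with parameters $\bigl((s+1)(st+1),\ s(t+1),\ s-1,\ t+1\bigr)$ (number of vertices, degree, number of common neighbours of two adjacent vertices, and of two distinct non-adjacent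 vertices), and its adjacency spectrum, with multiplicities, consists of $s(t+1)$ once, $s-1$ with multiplicity $f=\frac{s(s+1)t(t+1)}{s+t}$, and $-t-1$ with multiplicity $g=\frac{s^2(st+1)}{s+t}$ (in particular $f$ and $g$ are integers). -/

import Mathlib

open Filter Asymptotics

universe u v

/-- The spectrum (with multiplicities) of a finite simple graph: the multiset of
eigenvalues of its real adjacency matrix. -/
noncomputable def adjSpectrum {V : Type*} [Fintype V] (G : SimpleGraph V) : Multiset ℝ :=
  letI : DecidableEq V := Classical.decEq V
  letI : DecidableRel G.Adj := Classical.decRel _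
  Finset.univ.val.map (G.isHermitian_adjMatrix ℝ).eigenvalues

/-- The positive square energy `s⁺`: the sum of the squares of the positive eigenvalues. -/
noncomputable def posSquareEnergy {V : Type*} [Fintype V] (G : SimpleGraph V) : ℝ :=
  (((adjSpectrum G).filter fun x => 0 < x).map fun x => x ^ 2).sum

/-- The negative square energy `s⁻`: the sum of the squares of the negative eigenvalues. -/
noncomputable def negSquareEnergy {V : Type*} [Fintype V] (G : SimpleGraph V) : ℝ :=
  (((adjSpectrum G).filter fun x => x < 0).map fun x => x ^ 2).sum

/-- The incidence structure with points `P`, lines `L` and incidence relation `I` is a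
generalised quadrangle of order `(s, t)`. -/
structure IsGeneralizedQuadrangle {P L : Type*} (I : P → L → Prop) (s t : ℕ) : Prop where
  nonempty_points : Nonempty P
  one_le_s : 1 ≤ s
  one_le_t : 1 ≤ t
  /-- Every line is incident with exactly `s + 1` points. -/
  points_on_line : ∀ l : L, {x : P | I x l}.ncard = s + 1
  /-- Every point is incident with exactly `t + 1` lines. -/
  lines_through_point : ∀ x : P, {l : L | I x l}.ncard = t + 1
  /-- Two distinct points are on at most one common line; equivalently, two distinct lines
  have at most one common point. -/
  eq_or_eq : ∀ (x y : P) (l m : L), I x l → I y l → I x m → I y m → x = y ∨ l = m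
  /-- For a point `x` and a line `l` not incident with it there is a unique pair of a point `y`
  and a line `m` such that `x` is on `m`, and `y` is on both `m` and `l`. -/
  existsUnique_pair : ∀ (x : P) (l : L), ¬ I x l →
    ∃! ym : P × L, I x ym.2 ∧ I ym.1 ym.2 ∧ I ym.1 l

/-- The collinearity graph: the vertices are the points, and two distinct points are adjacent
if they are on a common line. -/
def collinearityGraph {P L : Type*} (I : P → L → Prop) : SimpleGraph P where
  Adj x y := x ≠ y ∧ ∃ l : L, I x l ∧ I y l
  symm := ⟨fun _ _ ⟨h, l, hx, hy⟩ => ⟨h.symm, l, hy, hx⟩⟩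
  loopless := ⟨fun _ h => h.1 rfl⟩

/-! For part (2), the axioms give the local counts of the collinearity graph directly, and the
double count `k (k - ℓ - 1) = (n - k - 1) μ` of a strongly regular graph gives the number of points.
An eigenvector with nonzero coordinate sum has eigenvalue `k`; any other eigenvalue is a root of a
quadratic, here `s - 1` or `-t - 1`. The traces of `1`, `A`, `A ^ 2` then fix the three
multiplicities, and in particular force that of `k` to be `1`.

For part (1), Tits' quadrangle `T₃(O)` is built from the elliptic quadric `Q = a c + N(x, y)` with
`N` anisotropic. Two affine points are collinear iff `Q` vanishes on their difference. Along a line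
with singular direction, `Q(· - w)` is affine in the parameter, so it has exactly one zero unless
its slope vanishes; in that case the line and `w` lie in the same polar hyperplane, which is itself
a point of the quadrangle. This dichotomy is the main case of the quadrangle axiom. By (2) the ratio
`s⁻ / s⁺` is `(q² + 1) / (2 q)`, while `n = (q + 1)(q³ + 1)` lies between `q⁴` and `(2 q)⁴`. -/

namespace IsGeneralizedQuadrangle

/-! ### Strong regularity of the collinearity graph. -/

variable {P : Type u} {L : Type v} {I : P → L → Prop} {s t : ℕ}

/-- A point not on a line is collinear with only one point of that line. -/
theorem eq_of_collinear (h : IsGeneralizedQuadrangle I s t) {x y z : P} {l m n : L}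
    (hx : ¬ I x l) (hy : I y l) (hz : I z l) (hxm : I x m) (hym : I y m) (hxn : I x n)
    (hzn : I z n) : y = z :=
  congrArg Prod.fst <| (h.existsUnique_pair x l hx).unique (y₁ := (y, m)) (y₂ := (z, n))
    ⟨hxm, hym, hy⟩ ⟨hxn, hzn, hz⟩

theorem ncard_neighborSet [Finite P] (h : IsGeneralizedQuadrangle I s t) (x : P) :
    ((collinearityGraph I).neighborSet x).ncard = s * (t + 1) := by
  classical
  -- `L` may be infinite, but an infinite set has `ncard` zero.
  have hfin : {l : L | I x l}.Finite :=
    Set.finite_of_ncard_ne_zero (by rw [h.lines_through_point x]; omega)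
  have key : (collinearityGraph I).neighborSet x =
      ⋃ l ∈ hfin.toFinset, ({y | I y l} \ {x}) := by
    ext y
    simp only [SimpleGraph.mem_neighborSet, collinearityGraph, Set.mem_iUnion, Set.mem_sdiff,
      Set.mem_ofPred_eq, Set.mem_singleton_iff, Set.Finite.mem_toFinset, exists_prop]
    constructor
    · rintro ⟨hne, l, hx, hy⟩
      exact ⟨l, hx, hy, fun e => hne e.symm⟩
    · rintro ⟨l, hx, hy, hne⟩
      exact ⟨fun e => hne e.symm, l, hx, hy⟩
  have hcard : ∀ l ∈ hfin.toFinset, ({y | I y l} \ {x}).ncard = s := by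
    intro l hl
    rw [Set.ncard_sdiff_singleton_of_mem (by simpa using hl), h.points_on_line, Nat.add_sub_cancel]
  have hdisj : (hfin.toFinset : Set L).PairwiseDisjoint fun l => ({y | I y l} \ {x}) := by
    intro l hl m hm hlm
    rw [Function.onFun, Set.disjoint_left]
    rintro y ⟨hyl, hyx⟩ ⟨hym, -⟩
    rcases h.eq_or_eq x y l m (by simpa using hl) hyl (by simpa using hm) hym with e | e
    · exact hyx e.symm
    · exact hlm e
  rw [key, Set.ncard_eq_toFinset_card _ (Set.toFinite _)]
  have : (Set.toFinite (⋃ l ∈ hfin.toFinset, ({y | I y l} \ {x}))).toFinset =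
      hfin.toFinset.biUnion fun l => (Set.toFinite ({y | I y l} \ {x})).toFinset := by
    ext y; simp [and_left_comm]
  rw [this, Finset.card_biUnion, Finset.sum_congr rfl fun l hl => by
    rw [← Set.ncard_eq_toFinset_card, hcard l hl], Finset.sum_const,
    ← Set.ncard_eq_toFinset_card _ hfin, h.lines_through_point, smul_eq_mul, mul_comm]
  intro l hl m hm hlm
  rw [Function.onFun, Set.Finite.disjoint_toFinset]
  exact hdisj (by simpa using hl) (by simpa using hm) hlm

/-- There are no triangles off a line: a point collinear with both `x` and `y` lies on their common
line. -/
theorem ncard_commonNeighbors_of_adj (h : IsGeneralizedQuadrangle I s t) {x y : P}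
    (hxy : (collinearityGraph I).Adj x y) :
    ((collinearityGraph I).commonNeighbors x y).ncard = s - 1 := by
  obtain ⟨hne, l, hx, hy⟩ := hxy
  have key : (collinearityGraph I).commonNeighbors x y = {z | I z l} \ {x, y} := by
    ext z
    simp only [SimpleGraph.mem_commonNeighbors, collinearityGraph, Set.mem_sdiff,
      Set.mem_ofPred_eq, Set.mem_insert_iff, Set.mem_singleton_iff, not_or]
    constructor
    · rintro ⟨⟨hxz, m, hxm, hzm⟩, ⟨hyz, n, hyn, hzn⟩⟩
      refine ⟨?_, fun e => hxz e.symm, fun e => hyz e.symm⟩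
      by_contra hz
      exact hne (h.eq_of_collinear hz hx hy hzm hxm hzn hyn)
    · rintro ⟨hz, hzx, hzy⟩
      exact ⟨⟨fun e => hzx e.symm, l, hx, hz⟩, ⟨fun e => hzy e.symm, l, hy, hz⟩⟩
  have hsub : ({x, y} : Set P) ⊆ {z | I z l} := by
    rintro z (rfl | rfl) <;> assumption
  rw [key, Set.ncard_sdiff hsub, h.points_on_line, Set.ncard_pair hne]
  omega

/-- Each line through `y` misses `x`, so it carries exactly one point collinear with `x`; this
matches lines through `y` with common neighbours. -/
theorem ncard_commonNeighbors_of_not_adj (h : IsGeneralizedQuadrangle I s t) {x y : P}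
    (hne : x ≠ y) (hxy : ¬ (collinearityGraph I).Adj x y) :
    ((collinearityGraph I).commonNeighbors x y).ncard = t + 1 := by
  have hnot : ∀ m, I y m → ¬ I x m := fun m hm hx => hxy ⟨hne, m, hx, hm⟩
  rw [← h.lines_through_point y]
  choose f hf hu using fun m : {m // I y m} => h.existsUnique_pair x m (hnot m m.2)
  have hfy : ∀ m, (f m).1 ≠ y := fun m e =>
    hnot _ (e ▸ (hf m).2.1) (hf m).1
  symm
  refine Set.ncard_congr (fun m hm => (f ⟨m, hm⟩).1) ?_ ?_ ?_
  · intro m hm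
    obtain ⟨h1, h2, h3⟩ := hf ⟨m, hm⟩
    refine ⟨⟨fun e => hnot m hm (by rw [e]; exact h3), _, h1, h2⟩,
      ⟨(hfy ⟨m, hm⟩).symm, m, hm, h3⟩⟩
  · intro m n hm hn hmn
    refine (h.eq_or_eq _ _ m n hm (hf ⟨m, hm⟩).2.2 hn ?_).resolve_left (hfy ⟨m, hm⟩).symm
    rw [show (f ⟨m, hm⟩).1 = (f ⟨n, hn⟩).1 from hmn]
    exact (hf ⟨n, hn⟩).2.2
  · rintro z ⟨⟨hxz, m, hxm, hzm⟩, ⟨hyz, n, hyn, hzn⟩⟩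
    exact ⟨n, hyn, (congrArg Prod.fst (hu ⟨n, hyn⟩ (z, m) ⟨hxm, hzm, hzn⟩)).symm⟩

/-- The collinearity graph of a finite generalised quadrangle is strongly regular. -/
theorem isSRGWith [Fintype P] [DecidableRel (collinearityGraph I).Adj]
    (h : IsGeneralizedQuadrangle I s t) :
    (collinearityGraph I).IsSRGWith ((s + 1) * (s * t + 1)) (s * (t + 1)) (s - 1) (t + 1) := by
  have := h.nonempty_points
  have hsrg : (collinearityGraph I).IsSRGWith
      (Fintype.card P) (s * (t + 1)) (s - 1) (t + 1) := by
    refine ⟨rfl, fun x => ?_, fun x y hxy => ?_, fun x y hne hxy => ?_⟩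
    · rw [← SimpleGraph.card_neighborSet_eq_degree, ← Nat.card_eq_fintype_card,
        Nat.card_coe_set_eq, h.ncard_neighborSet]
    · rw [← Nat.card_eq_fintype_card, Nat.card_coe_set_eq, h.ncard_commonNeighbors_of_adj hxy]
    · rw [← Nat.card_eq_fintype_card, Nat.card_coe_set_eq,
        h.ncard_commonNeighbors_of_not_adj hne hxy]
  -- The double count reads `s (t + 1) · s t = (n - k - 1)(t + 1)`, whence `n - k - 1 = s² t`.
  have hpar := hsrg.param_eq _ Fintype.card_pos
  obtain ⟨x⟩ := h.nonempty_points
  have hlt : s * (t + 1) < Fintype.card P := by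
    have := (collinearityGraph I).degree_lt_card_verts x
    rwa [hsrg.regular x] at this
  have hs := h.one_le_s
  obtain ⟨m, hm⟩ := Nat.exists_eq_add_of_lt hlt
  have h1 : s * (t + 1) - (s - 1) - 1 = s * t := by
    rw [mul_add]; omega
  have h2 : Fintype.card P - s * (t + 1) - 1 = m := by omega
  rw [h1, h2] at hpar
  have hm' : m = s * s * t := by
    apply Nat.eq_of_mul_eq_mul_right (Nat.succ_pos t)
    rw [Nat.succ_eq_add_one, ← hpar]; ring
  have hn : Fintype.card P = (s + 1) * (s * t + 1) := by rw [hm, hm']; ring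
  rw [hn] at hsrg
  exact hsrg

end IsGeneralizedQuadrangle

/-! ### Eigenvalues and multiplicities of strongly regular graphs. -/

open Matrix Finset in
/-- The sum of the squared eigenvalues of a real symmetric matrix is the trace of its square. -/
theorem Matrix.IsHermitian.trace_sq_eq_sum_eigenvalues_sq {n : Type*} [Fintype n] [DecidableEq n]
    {A : Matrix n n ℝ} (hA : A.IsHermitian) : (A ^ 2).trace = ∑ i, hA.eigenvalues i ^ 2 := by
  conv_lhs => rw [hA.spectral_theorem, ← map_pow, Unitary.conjStarAlgAut_apply, Matrix.trace_mul_comm,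
    ← mul_assoc]
  simp [Matrix.diagonal_pow, Matrix.trace_diagonal]

theorem Multiset.eq_replicate_add_replicate_add_replicate {α : Type*} (m : Multiset α) {x y z : α}
    (h : ∀ w ∈ m, w = x ∨ w = y ∨ w = z) :
    ∃ a b c : ℕ, m = Multiset.replicate a x + Multiset.replicate b y + Multiset.replicate c z := by
  induction m using Multiset.induction_on with
  | empty => exact ⟨0, 0, 0, by simp⟩
  | cons w m ih =>
    obtain ⟨a, b, c, rfl⟩ := ih fun v hv => h v (Multiset.mem_cons_of_mem hv)
    rcases h w (Multiset.mem_cons_self _ _) with rfl | rfl | rfl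
    · exact ⟨a + 1, b, c, by simp [Multiset.replicate_succ]⟩
    · exact ⟨a, b + 1, c, by simp [Multiset.replicate_succ]⟩
    · exact ⟨a, b, c + 1, by simp [Multiset.replicate_succ]⟩

namespace SimpleGraph

variable {V : Type u} [Fintype V] {G : SimpleGraph V}

theorem adjSpectrum_eq_map_eigenvalues [DecidableEq V] [DecidableRel G.Adj] :
    adjSpectrum G = Finset.univ.val.map (G.isHermitian_adjMatrix ℝ).eigenvalues := by
  unfold adjSpectrum
  congr!

theorem sum_adjSpectrum : (adjSpectrum G).sum = 0 := by
  classical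
  have := (G.isHermitian_adjMatrix ℝ).trace_eq_sum_eigenvalues
  rw [trace_adjMatrix] at this
  rw [adjSpectrum_eq_map_eigenvalues]
  exact this.symm

theorem card_adjSpectrum : (adjSpectrum G).card = Fintype.card V := by
  classical
  rw [adjSpectrum_eq_map_eigenvalues]
  simp

variable [DecidableRel G.Adj]

theorem IsRegularOfDegree.sum_sq_adjSpectrum {k : ℕ} (h : G.IsRegularOfDegree k) :
    ((adjSpectrum G).map fun x => x ^ 2).sum = (Fintype.card V * k : ℝ) := by
  classical
  have := (G.isHermitian_adjMatrix ℝ).trace_sq_eq_sum_eigenvalues_sq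
  rw [adjSpectrum_eq_map_eigenvalues, Multiset.map_map]
  refine this.symm.trans ?_
  simp only [Matrix.trace, Matrix.diag_apply, sq, adjMatrix_mul_self_apply_self, h.degree_eq,
    Finset.sum_const, Finset.card_univ, nsmul_eq_mul]

open Matrix in
/-- Every eigenvalue of a strongly regular graph is its degree or a root of
`X ^ 2 - (ℓ - μ) X - (k - μ)`. -/
theorem IsSRGWith.eq_or_sq_eq_of_mem_adjSpectrum {n k ℓ μ : ℕ} (h : G.IsSRGWith n k ℓ μ) {θ : ℝ}
    (hθ : θ ∈ adjSpectrum G) : θ = k ∨ θ ^ 2 = (ℓ - μ) * θ + (k - μ) := by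
  classical
  rw [adjSpectrum_eq_map_eigenvalues, Multiset.mem_map] at hθ
  obtain ⟨i, -, rfl⟩ := hθ
  set hA := G.isHermitian_adjMatrix ℝ
  set θ := hA.eigenvalues i
  set v : V → ℝ := ⇑(hA.eigenvectorBasis i)
  have hv : v ≠ 0 := fun e =>
    hA.eigenvectorBasis.orthonormal.ne_zero i (by ext j; exact congrFun e j)
  have hAv : G.adjMatrix ℝ *ᵥ v = θ • v := hA.mulVec_eigenvectorBasis i
  have hcompl : Gᶜ.adjMatrix ℝ = Matrix.of (fun _ _ => 1) - 1 - G.adjMatrix ℝ := by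
    ext a b
    by_cases hab : a = b
    · subst hab; simp
    · by_cases hadj : G.Adj a b <;> simp [hab, hadj, compl_adj]
  have hones : Matrix.of (fun _ _ => (1 : ℝ)) *ᵥ v = fun _ : V => ∑ j, v j := by
    ext a; simp [Matrix.mulVec, dotProduct]
  -- Apply `A² = k + ℓ A + μ (J - 1 - A)` to the eigenvector; `J` sees only the sum of its
  -- coordinates.
  have hsq := congrArg (· *ᵥ v) (h.matrix_eq (α := ℝ))
  simp only [sq, ← Matrix.mulVec_mulVec, hAv, Matrix.mulVec_smul, Matrix.add_mulVec,
    Matrix.smul_mulVec, Matrix.one_mulVec, hcompl, Matrix.sub_mulVec, hones] at hsq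
  have hpt : ∀ a, θ * (θ * v a) = k * v a + ℓ * (θ * v a) +
      μ * ((∑ j, v j) - v a - θ * v a) := fun a => by
    have := congrFun hsq a
    simp only [Pi.smul_apply, Pi.add_apply, Pi.sub_apply, smul_eq_mul] at this
    simp only [nsmul_eq_mul] at this
    linear_combination this
  by_cases hS : ∑ j, v j = 0
  · right
    obtain ⟨a, ha⟩ := Function.ne_iff.mp hv
    have := hpt a
    rw [hS] at this
    apply mul_right_cancel₀ ha
    linear_combination this
  · left
    -- Every column of `A` sums to `k`.
    have h1 : ∑ a, (G.adjMatrix ℝ *ᵥ v) a = k * ∑ j, v j := by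
      simp only [Matrix.mulVec, dotProduct]
      rw [Finset.sum_comm, Finset.mul_sum]
      refine Finset.sum_congr rfl fun j _ => ?_
      rw [← Finset.sum_mul]
      congr 1
      simp_rw [fun a => (G.isSymm_adjMatrix (α := ℝ)).apply j a]
      simp [adjMatrix_apply, Finset.sum_boole, ← h.regular j, ← neighborFinset_eq_filter]
    rw [hAv] at h1
    simp only [Pi.smul_apply, smul_eq_mul, ← Finset.mul_sum] at h1
    exact mul_right_cancel₀ hS h1

/-- The multiplicities in the spectrum of a strongly regular graph are determined by the first
three moments. -/
theorem IsSRGWith.exists_adjSpectrum_eq {n k ℓ μ : ℕ} (h : G.IsSRGWith n k ℓ μ) {r m : ℝ}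
    (hsum : r + m = ℓ - μ) (hprod : r * m = μ - k) :
    ∃ a b c : ℕ, adjSpectrum G = Multiset.replicate a (k : ℝ) + Multiset.replicate b r +
        Multiset.replicate c m ∧
      (a + b + c : ℝ) = n ∧ (a * k + b * r + c * m : ℝ) = 0 ∧
      (a * k ^ 2 + b * r ^ 2 + c * m ^ 2 : ℝ) = n * k := by
  obtain ⟨a, b, c, habc⟩ := (adjSpectrum G).eq_replicate_add_replicate_add_replicate
    (x := (k : ℝ)) (y := r) (z := m) fun θ hθ => by
      rcases h.eq_or_sq_eq_of_mem_adjSpectrum hθ with e | e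
      · exact Or.inl e
      · have : (θ - r) * (θ - m) = 0 := by linear_combination e - θ * hsum + hprod
        rcases mul_eq_zero.mp this with e | e
        · exact Or.inr (Or.inl (sub_eq_zero.mp e))
        · exact Or.inr (Or.inr (sub_eq_zero.mp e))
  refine ⟨a, b, c, habc, ?_, ?_, ?_⟩
  · have := card_adjSpectrum (G := G)
    rw [habc, h.card] at this
    simp only [Multiset.card_add, Multiset.card_replicate] at this
    exact_mod_cast this
  · have := sum_adjSpectrum (G := G)
    rw [habc] at this
    simpa using this
  · have := h.regular.sum_sq_adjSpectrum
    rw [habc, h.card] at this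
    simpa using this

end SimpleGraph

/-! ### Spectrum of the collinearity graph. -/

namespace IsGeneralizedQuadrangle

variable {P : Type u} {L : Type v} {I : P → L → Prop} {s t : ℕ}

/-- The spectrum of the collinearity graph of a finite generalised quadrangle. -/
theorem exists_adjSpectrum_eq [Fintype P] (h : IsGeneralizedQuadrangle I s t) :
    ∃ f g : ℕ,
      (f : ℝ) = (s * (s + 1) * t * (t + 1) : ℝ) / (s + t) ∧
      (g : ℝ) = (s ^ 2 * (s * t + 1) : ℝ) / (s + t) ∧
      adjSpectrum (collinearityGraph I) =
        {(s * (t + 1) : ℝ)} + Multiset.replicate f ((s : ℝ) - 1) +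
          Multiset.replicate g (-(t : ℝ) - 1) := by
  classical
  have hs : (1 : ℝ) ≤ s := by exact_mod_cast h.one_le_s
  have ht : (1 : ℝ) ≤ t := by exact_mod_cast h.one_le_t
  have hst : (s + t : ℝ) ≠ 0 := by positivity
  obtain ⟨a, b, c, hspec, h0, h1, h2⟩ := h.isSRGWith.exists_adjSpectrum_eq
    (r := (s : ℝ) - 1) (m := -(t : ℝ) - 1)
    (by push_cast [Nat.cast_sub h.one_le_s]; ring) (by push_cast; ring)
  push_cast at h0 h1 h2 hspec
  have ha : (a : ℝ) = 1 := by
    -- Summing `(X - r)(X - m)` over the spectrum isolates `a`; the factor is `(k - r)(k - m)`.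
    -- Below, `X - m` and `r - X` isolate `b` and `c` in the same way.
    have e : (s * t + 1 : ℝ) * ((s + 1) * (t + 1)) * (a - 1) = 0 := by
      linear_combination h2 - (s - t - 2 : ℝ) * h1 - (s - 1) * (t + 1 : ℝ) * h0
    have : (s * t + 1 : ℝ) * ((s + 1) * (t + 1)) ≠ 0 := by positivity
    exact sub_eq_zero.mp ((mul_eq_zero.mp e).resolve_left this)
  rw [ha] at h0 h1
  obtain rfl : a = 1 := by exact_mod_cast ha
  refine ⟨b, c, ?_, ?_, by rw [hspec, Multiset.replicate_one]⟩
  · rw [eq_div_iff hst]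
    linear_combination (t + 1 : ℝ) * h0 + h1
  · rw [eq_div_iff hst]
    linear_combination (s - 1 : ℝ) * h0 - h1

end IsGeneralizedQuadrangle

/-! ### Affine geometry of the elliptic quadric. -/

namespace EllipticQuadrangle

variable {F : Type*} [Field F]

/-- A finite field carries an irreducible polynomial of the form `X ^ 2 + X + γ`. -/
theorem exists_forall_sq_add_self_add_ne_zero (F : Type*) [Field F] [Finite F] :
    ∃ γ : F, ∀ x : F, x ^ 2 + x + γ ≠ 0 := by
  -- The map vanishes at both `0` and `-1`, in every characteristic.
  have hinj : ¬ Function.Injective fun x : F => x ^ 2 + x := fun h => by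
    have := @h 0 (-1) (by ring)
    exact one_ne_zero (neg_eq_zero.mp this.symm)
  have hsurj : ¬ Function.Surjective fun x : F => x ^ 2 + x :=
    fun h => hinj (Finite.injective_iff_surjective.mpr h)
  simp only [Function.Surjective, not_forall, not_exists] at hsurj
  obtain ⟨b, hb⟩ := hsurj
  exact ⟨-b, fun x hx => hb x (by linear_combination hx)⟩

/-- The binary quadratic form `x ^ 2 + x y + γ y ^ 2`. -/
def norm (γ x y : F) : F := x ^ 2 + x * y + γ * y ^ 2

/-- The polar form of `norm γ`. -/
def polar (γ x y x' y' : F) : F := 2 * x * x' + x * y' + y * x' + 2 * γ * y * y'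

theorem norm_eq_zero {γ : F} (hγ : ∀ x : F, x ^ 2 + x + γ ≠ 0) {x y : F} (h : norm γ x y = 0) :
    x = 0 ∧ y = 0 := by
  unfold norm at h
  by_cases hy : y = 0
  · subst hy
    exact ⟨by simpa using h, rfl⟩
  · refine absurd ?_ (hγ (x / y))
    field_simp
    linear_combination h

/-- Affine points: vectors `(a, x, y, c)` of the four-dimensional space with the quadratic form
`a c + norm γ x y`. -/
abbrev Affine (F : Type*) := F × F × F × F

/-- The points of the elliptic quadric at infinity: `some (k, k')` is spanned by
`(1, k, k', - norm γ k k')` and `none` by `(0, 0, 0, 1)`. -/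
abbrev Direction (F : Type*) := Option (F × F)

/-- The quadratic form `a c + norm γ x y` of elliptic type. -/
def quad (γ : F) : Affine F → F
  | (a, x, y, c) => a * c + norm γ x y

/-- The projection of the affine space along a direction; its fibres are the affine lines
with that direction. -/
def proj (γ : F) : Direction F → Affine F → F × F × F
  | some (k, k'), (a, x, y, c) => (x - a * k, y - a * k', c + a * norm γ k k')
  | none, (a, x, y, _) => (a, x, y)

/-- A parametrization of the fibres of `proj`. -/
def linePoint (γ : F) : Direction F → F × F × F → F → Affine F
  | some (k, k'), (x, y, c), r => (r, x + r * k, y + r * k', c - r * norm γ k k')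
  | none, (a, x, y), r => (a, x, y, r)

/-- The linear functional "polar form with the direction", on the lines with that direction. -/
def height (γ : F) : Direction F → F × F × F → F
  | some (k, k'), (x, y, c) => c + polar γ k k' x y
  | none, (a, _, _) => a

/-- A parametrization of the fibres of `height`. -/
def heightLine (γ : F) : Direction F → F → F × F → F × F × F
  | some (k, k'), b, (x, y) => (x, y, b - polar γ k k' x y)
  | none, b, (x, y) => (b, x, y)

/-- The polar form of two directions. -/
def slope (γ : F) : Direction F → Direction F → F
  | some (k, k'), some (l, l') => - norm γ (k - l) (k' - l')
  | some _, none => 1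
  | none, some _ => 1
  | none, none => 0

variable {γ : F}

theorem slope_ne_zero (hγ : ∀ x : F, x ^ 2 + x + γ ≠ 0) {o o' : Direction F} (h : o ≠ o') :
    slope γ o o' ≠ 0 := by
  rcases o with _ | ⟨k, k'⟩ <;> rcases o' with _ | ⟨l, l'⟩
  · exact absurd rfl h
  · exact one_ne_zero
  · exact one_ne_zero
  · intro h0
    obtain ⟨h1, h2⟩ := norm_eq_zero hγ (neg_eq_zero.mp h0)
    exact h (by rw [sub_eq_zero.mp h1, sub_eq_zero.mp h2])

theorem proj_linePoint (o : Direction F) (u : F × F × F) (r : F) :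
    proj γ o (linePoint γ o u r) = u := by
  rcases o with _ | ⟨k, k'⟩ <;> obtain ⟨x, y, c⟩ := u <;> simp [proj, linePoint]

theorem linePoint_injective (o : Direction F) (u : F × F × F) :
    Function.Injective (linePoint γ o u) := by
  rcases o with _ | ⟨k, k'⟩ <;> obtain ⟨x, y, c⟩ := u <;> intro r r' h <;>
    simp only [linePoint, Prod.mk.injEq] at h <;> tauto

theorem exists_linePoint_eq (o : Direction F) (w : Affine F) :
    ∃ r, linePoint γ o (proj γ o w) r = w := by
  rcases o with _ | ⟨k, k'⟩ <;> obtain ⟨a, x, y, c⟩ := w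
  · exact ⟨c, rfl⟩
  · exact ⟨a, by simp [proj, linePoint]⟩

theorem height_heightLine (o : Direction F) (b : F) (e : F × F) :
    height γ o (heightLine γ o b e) = b := by
  rcases o with _ | ⟨k, k'⟩ <;> obtain ⟨x, y⟩ := e <;> simp [height, heightLine]

theorem heightLine_injective (o : Direction F) (b : F) :
    Function.Injective (heightLine γ o b) := by
  rcases o with _ | ⟨k, k'⟩ <;> rintro ⟨x, y⟩ ⟨x', y'⟩ h <;>
    simp only [heightLine, Prod.mk.injEq] at h ⊢ <;> tauto

theorem exists_heightLine_eq (o : Direction F) (u : F × F × F) :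
    ∃ e, heightLine γ o (height γ o u) e = u := by
  rcases o with _ | ⟨k, k'⟩ <;> obtain ⟨x, y, c⟩ := u
  · exact ⟨(y, c), rfl⟩
  · exact ⟨(x, y), by simp [height, heightLine]⟩

/-- Linearity of the polar functional of `o` along a line with direction `o'`. -/
theorem height_proj_linePoint (o o' : Direction F) (u : F × F × F) (r : F) :
    height γ o (proj γ o (linePoint γ o' u r)) =
      height γ o (proj γ o (linePoint γ o' u 0)) + r * slope γ o o' := by
  rcases o with _ | ⟨k, k'⟩ <;> rcases o' with _ | ⟨l, l'⟩ <;> obtain ⟨x, y, c⟩ := u <;>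
    simp only [height, proj, linePoint, slope, polar, norm] <;> ring

/-- In the expansion of `Q(p + r d - w)` the term `r² Q(d)` vanishes because `d` is singular, and
the linear coefficient is the polar form of `d` with `p - w`. -/
theorem quad_linePoint_sub (o : Direction F) (u : F × F × F) (w : Affine F) (r : F) :
    quad γ (linePoint γ o u r - w) =
      quad γ (linePoint γ o u 0 - w) + r * (height γ o u - height γ o (proj γ o w)) := by
  rcases o with _ | ⟨k, k'⟩ <;> obtain ⟨x, y, c⟩ := u <;> obtain ⟨a', x', y', c'⟩ := w <;>
    simp only [height, proj, linePoint, quad, polar, norm, Prod.mk_sub_mk] <;> ring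

/-- A singular vector is a multiple of a direction vector: scale it to first coordinate `1`, or, if
that coordinate is `0`, anisotropy of `norm γ` leaves only the last one. -/
theorem quad_sub_eq_zero_iff (hγ : ∀ x : F, x ^ 2 + x + γ ≠ 0) (w w' : Affine F) :
    quad γ (w' - w) = 0 ↔ ∃ o, proj γ o w = proj γ o w' := by
  obtain ⟨a, x, y, c⟩ := w
  obtain ⟨a', x', y', c'⟩ := w'
  simp only [quad, Prod.mk_sub_mk]
  constructor
  · intro h
    by_cases ha : a' - a = 0
    · rw [ha, zero_mul, zero_add] at h
      obtain ⟨h1, h2⟩ := norm_eq_zero hγ h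
      exact ⟨none, by simp only [proj]; rw [sub_eq_zero.mp ha, sub_eq_zero.mp h1, sub_eq_zero.mp h2]⟩
    · refine ⟨some ((x' - x) / (a' - a), (y' - y) / (a' - a)), ?_⟩
      have hnorm : norm γ ((x' - x) / (a' - a)) ((y' - y) / (a' - a)) =
          -(c' - c) / (a' - a) := by
        unfold norm at h ⊢
        field_simp
        linear_combination h
      simp only [proj, Prod.mk.injEq, hnorm]
      refine ⟨?_, ?_, ?_⟩ <;> field_simp <;> ring
  · rintro ⟨_ | ⟨k, k'⟩, h⟩ <;> simp only [proj, Prod.mk.injEq] at h <;> obtain ⟨h1, h2, h3⟩ := h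
    · subst h1 h2 h3; simp [norm]
    · obtain rfl : x' = x + (a' - a) * k := by linear_combination -h1
      obtain rfl : y' = y + (a' - a) * k' := by linear_combination -h2
      obtain rfl : c' = c - (a' - a) * norm γ k k' := by linear_combination -h3
      unfold norm; ring

/-- An affine line with direction `o'` meets each hyperplane polar to another direction `o` in
exactly one point. -/
theorem existsUnique_height_eq (hγ : ∀ x : F, x ^ 2 + x + γ ≠ 0) {o o' : Direction F}
    (h : o ≠ o') (u : F × F × F) (b : F) :
    ∃! w, proj γ o' w = u ∧ height γ o (proj γ o w) = b := by
  have hs := slope_ne_zero hγ h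
  refine ⟨linePoint γ o' u
    ((b - height γ o (proj γ o (linePoint γ o' u 0))) / slope γ o o'),
    ⟨proj_linePoint _ _ _, ?_⟩, ?_⟩
  · rw [height_proj_linePoint, div_mul_cancel₀ _ hs]; ring
  · rintro w ⟨rfl, hb⟩
    obtain ⟨r, hr⟩ := exists_linePoint_eq (γ := γ) o' w
    rw [← hr, height_proj_linePoint] at hb
    conv_lhs => rw [← hr]
    congr 1
    rw [eq_div_iff hs]
    linear_combination hb

theorem eq_or_eq_of_proj_eq (hγ : ∀ x : F, x ^ 2 + x + γ ≠ 0) {o o' : Direction F}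
    {w w' : Affine F} (h : proj γ o w = proj γ o w') (h' : proj γ o' w = proj γ o' w') :
    w = w' ∨ o = o' := by
  by_cases ho : o = o'
  · exact Or.inr ho
  · exact Or.inl <| (existsUnique_height_eq hγ ho (proj γ o' w') (height γ o (proj γ o w'))).unique
      ⟨h', by rw [h]⟩ ⟨rfl, rfl⟩

/-- An affine point outside an affine line, but in the same hyperplane polar to the direction of
the line, is collinear with no affine point of the line. -/
theorem proj_ne_of_height_eq (hγ : ∀ x : F, x ^ 2 + x + γ ≠ 0) {o o' : Direction F}
    {w w' : Affine F} (hne : proj γ o w ≠ proj γ o w')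
    (h : height γ o (proj γ o w) = height γ o (proj γ o w')) : proj γ o' w ≠ proj γ o' w' := by
  intro h'
  by_cases ho : o = o'
  · exact hne (ho ▸ h')
  · exact hne <| congrArg _ <| (existsUnique_height_eq hγ ho (proj γ o' w')
      (height γ o (proj γ o w'))).unique ⟨h', h⟩ ⟨rfl, rfl⟩

/-- Every other affine point is collinear with exactly one affine point of the line. -/
theorem existsUnique_of_height_ne (hγ : ∀ x : F, x ^ 2 + x + γ ≠ 0) {o : Direction F}
    {w : Affine F} {u : F × F × F} (h : height γ o (proj γ o w) ≠ height γ o u) :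
    ∃! w', proj γ o w' = u ∧ ∃ o', proj γ o' w = proj γ o' w' := by
  have hs : height γ o u - height γ o (proj γ o w) ≠ 0 := sub_ne_zero.mpr h.symm
  simp only [← quad_sub_eq_zero_iff hγ]
  -- The parameter is the only zero of the affine function in `quad_linePoint_sub`.
  refine ⟨linePoint γ o u (-quad γ (linePoint γ o u 0 - w) /
    (height γ o u - height γ o (proj γ o w))), ⟨proj_linePoint _ _ _, ?_⟩, ?_⟩
  · rw [quad_linePoint_sub, div_mul_cancel₀ _ hs]; ring
  · rintro w' ⟨rfl, hq⟩
    obtain ⟨r, hr⟩ := exists_linePoint_eq (γ := γ) o w'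
    rw [← hr, quad_linePoint_sub] at hq
    conv_lhs => rw [← hr]
    congr 1
    rw [eq_div_iff hs]
    linear_combination hq

/-! ### The incidence structure and its axioms. -/

/-- The points of the quadrangle: a point at infinity, the affine points, and the translates of
the hyperplanes polar to the directions. -/
abbrev Point (F : Type*) := Option (Affine F ⊕ Direction F × F)

/-- The lines of the quadrangle: the directions and the affine lines with these directions. -/
abbrev Line (F : Type*) := Direction F ⊕ Direction F × (F × F × F)

/-- The incidence relation of Tits' quadrangle `T₃(O)` of the elliptic quadric. -/
def incidence (γ : F) : Point F → Line F → Prop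
  | none, Sum.inl _ => True
  | none, Sum.inr _ => False
  | some (Sum.inl _), Sum.inl _ => False
  | some (Sum.inl w), Sum.inr (o, u) => proj γ o w = u
  | some (Sum.inr (o, _)), Sum.inl o' => o = o'
  | some (Sum.inr (o, b)), Sum.inr (o', u) => o = o' ∧ height γ o u = b

theorem ncard_points_on_line [Fintype F] (l : Line F) :
    {x : Point F | incidence γ x l}.ncard = Fintype.card F + 1 := by
  rcases l with o | ⟨o, u⟩
  · have : {x : Point F | incidence γ x (Sum.inl o)} =
        insert none ((fun b : F => some (Sum.inr (o, b))) '' Set.univ) := by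
      ext x
      rcases x with _ | w | ⟨o', b⟩ <;> simp [incidence, eq_comm]
    rw [this, Set.ncard_insert_of_notMem (by simp), Set.ncard_image_of_injective, Set.ncard_univ,
      Nat.card_eq_fintype_card]
    intro b b' h
    simpa using h
  · have : {x : Point F | incidence γ x (Sum.inr (o, u))} =
        insert (some (Sum.inr (o, height γ o u)))
          ((fun r : F => some (Sum.inl (linePoint γ o u r))) '' Set.univ) := by
      ext x
      rcases x with _ | w | ⟨o', b⟩
      · simp [incidence]
      · simp only [incidence, Set.mem_ofPred_eq, Set.image_univ, Set.mem_insert_iff,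
          Option.some.injEq, reduceCtorEq, Set.mem_range, Sum.inl.injEq, false_or]
        exact ⟨fun h => h ▸ exists_linePoint_eq o w, fun ⟨r, hr⟩ => hr ▸ proj_linePoint o u r⟩
      · simp only [incidence, Set.mem_ofPred_eq, Set.image_univ, Set.mem_insert_iff,
          Option.some.injEq, reduceCtorEq, Set.mem_range, Sum.inr.injEq, Prod.mk.injEq,
          exists_const, or_false]
        constructor <;> (rintro ⟨rfl, rfl⟩; exact ⟨rfl, rfl⟩)
    rw [this, Set.ncard_insert_of_notMem (by simp), Set.ncard_image_of_injective, Set.ncard_univ,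
      Nat.card_eq_fintype_card]
    intro r r' h
    exact linePoint_injective (γ := γ) o u (by simpa using h)

theorem ncard_lines_through_point [Fintype F] (x : Point F) :
    {l : Line F | incidence γ x l}.ncard = Fintype.card F ^ 2 + 1 := by
  have hcard : Nat.card (Direction F) = Fintype.card F ^ 2 + 1 := by
    rw [Nat.card_eq_fintype_card, Fintype.card_option, Fintype.card_prod, sq]
  rcases x with _ | w | ⟨o, b⟩
  · have : {l : Line F | incidence γ none l} = Sum.inl '' Set.univ := by
      ext l
      rcases l with o | ⟨o, u⟩ <;> simp [incidence]
    rw [this, Set.ncard_image_of_injective _ Sum.inl_injective, Set.ncard_univ, hcard]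
  · have : {l : Line F | incidence γ (some (Sum.inl w)) l} =
        (fun o => Sum.inr (o, proj γ o w)) '' Set.univ := by
      ext l
      rcases l with o | ⟨o, u⟩ <;> simp [incidence]
    rw [this, Set.ncard_image_of_injective, Set.ncard_univ, hcard]
    intro o o' h
    simp only [Sum.inr.injEq, Prod.mk.injEq] at h
    exact h.1
  · have : {l : Line F | incidence γ (some (Sum.inr (o, b))) l} =
        insert (Sum.inl o) ((fun e => Sum.inr (o, heightLine γ o b e)) '' Set.univ) := by
      ext l
      rcases l with o' | ⟨o', u⟩
      · simp [incidence, eq_comm]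
      · simp only [incidence, Set.mem_ofPred_eq, Set.image_univ, Set.mem_insert_iff,
          reduceCtorEq, Set.mem_range, Sum.inr.injEq, Prod.mk.injEq, false_or, exists_and_left]
        constructor
        · rintro ⟨rfl, rfl⟩
          exact ⟨rfl, exists_heightLine_eq o u⟩
        · rintro ⟨rfl, e, rfl⟩
          exact ⟨rfl, height_heightLine o b e⟩
    rw [this, Set.ncard_insert_of_notMem (by simp), Set.ncard_image_of_injective, Set.ncard_univ,
      Nat.card_eq_fintype_card, Fintype.card_prod, sq]
    intro e e' h
    exact heightLine_injective (γ := γ) o b (by simpa using h)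

theorem incidence_eq_or_eq (hγ : ∀ x : F, x ^ 2 + x + γ ≠ 0) (x y : Point F) (l m : Line F)
    (hxl : incidence γ x l) (hyl : incidence γ y l) (hxm : incidence γ x m)
    (hym : incidence γ y m) : x = y ∨ l = m := by
  rcases x with _ | w | ⟨o, b⟩ <;> rcases y with _ | w' | ⟨o', b'⟩ <;>
    rcases l with o₁ | ⟨o₁, u₁⟩ <;> rcases m with o₂ | ⟨o₂, u₂⟩ <;>
    simp only [incidence] at hxl hyl hxm hym
  -- Two affine points on two affine lines: the only case that uses the quadric.
  case some.inl.some.inl.inr.inr =>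
    rcases eq_or_eq_of_proj_eq hγ (hxl.trans hyl.symm) (hxm.trans hym.symm) with rfl | rfl
    · exact Or.inl rfl
    · exact Or.inr (by rw [← hxl, ← hxm])
  all_goals grind

theorem incidence_existsUnique_pair (hγ : ∀ x : F, x ^ 2 + x + γ ≠ 0) (x : Point F) (l : Line F)
    (h : ¬ incidence γ x l) :
    ∃! ym : Point F × Line F,
      incidence γ x ym.2 ∧ incidence γ ym.1 ym.2 ∧ incidence γ ym.1 l := by
  rcases x with _ | w | ⟨o, b⟩ <;> rcases l with o' | ⟨o', u⟩ <;> simp only [incidence] at h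
  · exact absurd trivial h
  · refine ⟨(some (Sum.inr (o', height γ o' u)), Sum.inl o'), by simp [incidence], ?_⟩
    rintro ⟨_ | w | ⟨o, b⟩, p | ⟨p, v⟩⟩ <;> simp only [incidence] <;> grind
  · refine ⟨(some (Sum.inr (o', height γ o' (proj γ o' w))), Sum.inr (o', proj γ o' w)),
      by simp [incidence], ?_⟩
    rintro ⟨_ | w | ⟨o, b⟩, p | ⟨p, v⟩⟩ <;> simp only [incidence] <;> grind
  -- If `w` and the line share a polar hyperplane, the parallel through `w` meets the line in that
  -- hyperplane, taken as a point; otherwise they are joined at an affine point.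
  · by_cases hh : height γ o' (proj γ o' w) = height γ o' u
    · refine ⟨(some (Sum.inr (o', height γ o' u)), Sum.inr (o', proj γ o' w)),
        by simp [incidence, hh], ?_⟩
      rintro ⟨_ | w' | ⟨o, b⟩, p | ⟨p, v⟩⟩ <;> simp only [incidence]
      case some.inl.inr =>
        rintro ⟨h1, h2, rfl⟩
        exact absurd (h1.trans h2.symm) (proj_ne_of_height_eq hγ h hh)
      all_goals grind
    · obtain ⟨w', ⟨h1, p, h2⟩, hu⟩ := existsUnique_of_height_ne hγ hh
      refine ⟨(some (Sum.inl w'), Sum.inr (p, proj γ p w')), ⟨h2, rfl, h1⟩, ?_⟩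
      rintro ⟨_ | w'' | ⟨o, b⟩, p' | ⟨p', v⟩⟩ <;> simp only [incidence]
      case some.inl.inr =>
        rintro ⟨h3, rfl, h4⟩
        obtain rfl := hu w'' ⟨h4, p', h3⟩
        rcases eq_or_eq_of_proj_eq hγ h2 h3 with rfl | rfl
        · exact absurd h4 h
        · rfl
      all_goals grind
  · refine ⟨(none, Sum.inl o), by simp [incidence], ?_⟩
    rintro ⟨_ | w | ⟨o, b⟩, p | ⟨p, v⟩⟩ <;> simp only [incidence] <;> grind
  · by_cases ho : o = o'
    · subst ho
      refine ⟨(some (Sum.inr (o, height γ o u)), Sum.inl o), by simp [incidence], ?_⟩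
      rintro ⟨_ | w | ⟨o, b⟩, p | ⟨p, v⟩⟩ <;> simp only [incidence] <;> grind
    · obtain ⟨w, ⟨h1, h2⟩, hu⟩ := existsUnique_height_eq hγ ho u b
      refine ⟨(some (Sum.inl w), Sum.inr (o, proj γ o w)), ⟨⟨rfl, h2⟩, rfl, h1⟩, ?_⟩
      rintro ⟨_ | w' | ⟨o, b⟩, p | ⟨p, v⟩⟩ <;> simp only [incidence]
      case some.inl.inr =>
        rintro ⟨⟨rfl, h3⟩, rfl, h4⟩
        rw [hu w' ⟨h4, h3⟩]
      all_goals grind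

theorem isGeneralizedQuadrangle [Fintype F] (hγ : ∀ x : F, x ^ 2 + x + γ ≠ 0) :
    IsGeneralizedQuadrangle (incidence γ) (Fintype.card F) (Fintype.card F ^ 2) where
  nonempty_points := ⟨none⟩
  one_le_s := Fintype.card_pos
  one_le_t := Nat.pow_pos Fintype.card_pos
  points_on_line := ncard_points_on_line
  lines_through_point := ncard_lines_through_point
  eq_or_eq := incidence_eq_or_eq hγ
  existsUnique_pair := incidence_existsUnique_pair hγ

end EllipticQuadrangle

/-! ### Square energies and asymptotics. -/

/-- For every prime power `q` there is a finite generalised quadrangle of order `(q, q ^ 2)`. -/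
theorem IsPrimePow.exists_isGeneralizedQuadrangle {q : ℕ} (hq : IsPrimePow q) :
    ∃ (P L : Type) (_ : Fintype P) (I : P → L → Prop), IsGeneralizedQuadrangle I q (q ^ 2) := by
  obtain ⟨p, k, hp, hk, rfl⟩ := hq
  have : Fact p.Prime := ⟨hp.nat_prime⟩
  have := Fintype.ofFinite (GaloisField p k)
  obtain ⟨γ, hγ⟩ := EllipticQuadrangle.exists_forall_sq_add_self_add_ne_zero (GaloisField p k)
  have h := EllipticQuadrangle.isGeneralizedQuadrangle hγ
  rw [← Nat.card_eq_fintype_card, GaloisField.card p k hk.ne'] at h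
  exact ⟨_, _, Fintype.ofFinite _, _, h⟩

namespace IsGeneralizedQuadrangle

variable {P : Type u} {L : Type v} [Fintype P] {I : P → L → Prop}

theorem card_eq {s t : ℕ} (h : IsGeneralizedQuadrangle I s t) :
    Fintype.card P = (s + 1) * (s * t + 1) := by
  classical exact h.isSRGWith.card

theorem square_energies_eq {s t : ℕ} (h : IsGeneralizedQuadrangle I s t) (hs : 1 < s) :
    negSquareEnergy (collinearityGraph I) =
        (s ^ 2 * (s * t + 1) : ℝ) / (s + t) * (t + 1) ^ 2 ∧
      posSquareEnergy (collinearityGraph I) =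
        (s * (t + 1) : ℝ) ^ 2 + (s * (s + 1) * t * (t + 1) : ℝ) / (s + t) * (s - 1) ^ 2 := by
  obtain ⟨f, g, hf, hg, hspec⟩ := h.exists_adjSpectrum_eq
  have hs' : (1 : ℝ) < s := by exact_mod_cast hs
  have hk : (0 : ℝ) < s * (t + 1) := by positivity
  have hr : (0 : ℝ) < s - 1 := by linarith
  have hm : (-t - 1 : ℝ) < 0 := by have : (0 : ℝ) ≤ t := t.cast_nonneg
                                   linarith
  have hfilter : ∀ (p : ℝ → Prop) [DecidablePred p] (a : ℕ) (x : ℝ),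
      (Multiset.replicate a x).filter p = if p x then Multiset.replicate a x else 0 := by
    intro p _ a x
    split_ifs with hp
    · exact Multiset.filter_eq_self.mpr fun y hy => Multiset.eq_of_mem_replicate hy ▸ hp
    · exact Multiset.filter_eq_nil.mpr fun y hy => Multiset.eq_of_mem_replicate hy ▸ hp
  rw [negSquareEnergy, posSquareEnergy, hspec, ← hf, ← hg, ← Multiset.replicate_one]
  simp only [Multiset.filter_add, hfilter, hk, hr, hm, hk.not_gt, hr.not_gt, hm.not_gt, if_true,
    if_false, zero_add, add_zero, Multiset.map_add, Multiset.map_replicate, Multiset.sum_add,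
    Multiset.sum_replicate, nsmul_eq_mul, Nat.cast_one, one_mul]
  exact ⟨by ring, trivial⟩

theorem negSquareEnergy_div_posSquareEnergy {q : ℕ} (h : IsGeneralizedQuadrangle I q (q ^ 2))
    (hq : 1 < q) :
    negSquareEnergy (collinearityGraph I) / posSquareEnergy (collinearityGraph I) =
      (q ^ 2 + 1 : ℝ) / (2 * q) := by
  obtain ⟨h1, h2⟩ := h.square_energies_eq hq
  have hq' : (1 : ℝ) < q := by exact_mod_cast hq
  have h0 : (0 : ℝ) < (q : ℝ) ^ 2 - q + 1 := by nlinarith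
  have e1 : ((q : ℝ) ^ 2 * (q * (q ^ 2 : ℕ) + 1)) / (q + (q ^ 2 : ℕ)) = q * (q ^ 2 - q + 1) := by
    push_cast
    field_simp
    ring
  have e2 : (q * (q + 1) * (q ^ 2 : ℕ) * ((q ^ 2 : ℕ) + 1) : ℝ) / (q + (q ^ 2 : ℕ)) =
      q ^ 2 * (q ^ 2 + 1) := by
    push_cast
    field_simp
    ring
  have e3 : (q * ((q ^ 2 : ℕ) + 1) : ℝ) ^ 2 + q ^ 2 * (q ^ 2 + 1) * (q - 1) ^ 2 =
      2 * q ^ 2 * (q ^ 2 + 1) * (q ^ 2 - q + 1) := by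
    push_cast
    ring
  rw [h1, h2, e1, e2, e3]
  push_cast
  rw [div_eq_div_iff (by positivity) (by positivity)]
  ring

end IsGeneralizedQuadrangle

theorem exists_generalizedQuadrangle_family_isTheta :
    ∃ (P L : {q : ℕ // IsPrimePow q} → Type) (_ : ∀ q, Fintype (P q))
        (I : ∀ q, P q → L q → Prop),
      (∀ q, IsGeneralizedQuadrangle (I q) (q : ℕ) ((q : ℕ) ^ 2)) ∧
      Tendsto (fun q => Fintype.card (P q)) atTop atTop ∧
      (fun q => negSquareEnergy (collinearityGraph (I q)) /
          posSquareEnergy (collinearityGraph (I q)))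
        =Θ[atTop] (fun q => (Fintype.card (P q) : ℝ) ^ (1 / 4 : ℝ)) := by
  choose P L hP I hI using fun q : {q : ℕ // IsPrimePow q} => q.2.exists_isGeneralizedQuadrangle
  have hcard : ∀ q, (Fintype.card (P q) : ℝ) = (q + 1) * (q * q ^ 2 + 1) := fun q => by
    rw [(hI q).card_eq]; push_cast; rfl
  have hone : ∀ q : {q : ℕ // IsPrimePow q}, (1 : ℝ) < (q : ℕ) := fun q => by
    exact_mod_cast q.2.one_lt
  have hlower : ∀ q : {q : ℕ // IsPrimePow q},
      ((q : ℕ) : ℝ) ≤ (Fintype.card (P q) : ℝ) ^ (1 / 4 : ℝ) := fun q => by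
    have := hone q
    rw [one_div, Real.le_rpow_inv_iff_of_pos (by positivity) (by positivity) (by norm_num), hcard]
    norm_cast
    nlinarith [Nat.zero_le ((q : ℕ) * (q : ℕ) ^ 2)]
  have hupper : ∀ q : {q : ℕ // IsPrimePow q},
      (Fintype.card (P q) : ℝ) ^ (1 / 4 : ℝ) ≤ 2 * (q : ℕ) := fun q => by
    have := hone q
    rw [one_div, Real.rpow_inv_le_iff_of_pos (by positivity) (by positivity) (by norm_num), hcard]
    norm_num
    calc ((q : ℕ) + 1 : ℝ) * ((q : ℕ) * (q : ℕ) ^ 2 + 1)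
        ≤ ((q : ℕ) + (q : ℕ)) * ((q : ℕ) * (q : ℕ) ^ 2 + (q : ℕ) * (q : ℕ) ^ 2) := by
          gcongr
          nlinarith [mul_pos (zero_lt_one.trans this) (zero_lt_one.trans this)]
      _ ≤ _ := by nlinarith [pow_pos (zero_lt_one.trans this) 4]
  refine ⟨P, L, hP, I, hI, ?_, ?_, ?_⟩
  · refine tendsto_atTop.mpr fun b => ?_
    obtain ⟨p, hbp, hp⟩ := Nat.exists_infinite_primes b
    filter_upwards [eventually_ge_atTop ⟨p, hp.isPrimePow⟩] with q hq
    have : p ≤ q := hq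
    rw [(hI q).card_eq]
    nlinarith [Nat.zero_le ((q : ℕ) * (q : ℕ) ^ 2), Nat.zero_le ((q : ℕ) * ((q : ℕ) * (q : ℕ) ^ 2))]
  · refine IsBigO.of_bound 1 (Eventually.of_forall fun q => ?_)
    have := hone q
    rw [(hI q).negSquareEnergy_div_posSquareEnergy q.2.one_lt, Real.norm_of_nonneg (by positivity),
      Real.norm_of_nonneg (by positivity), one_mul]
    refine le_trans ?_ (hlower q)
    rw [div_le_iff₀ (by positivity)]
    nlinarith
  -- The constant `4` suffices since `n ^ (1/4) ≤ 2 q` and the ratio exceeds `q / 2`.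
  · refine IsBigO.of_bound 4 (Eventually.of_forall fun q => ?_)
    have := hone q
    rw [(hI q).negSquareEnergy_div_posSquareEnergy q.2.one_lt, Real.norm_of_nonneg (by positivity),
      Real.norm_of_nonneg (by positivity)]
    refine (hupper q).trans ?_
    rw [mul_div_assoc', le_div_iff₀ (by positivity)]
    nlinarith

theorem mainTheorem3 :
    -- a family, indexed by the prime powers, of generalised quadrangles of order `(q, q²)`
    -- whose collinearity graphs satisfy `s⁻ / s⁺ = Θ(n ^ (1/4))` as `n → ∞`
    (∃ (P L : {q : ℕ // IsPrimePow q} → Type) (_ : ∀ q, Fintype (P q))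
        (I : ∀ q, P q → L q → Prop),
      (∀ q, IsGeneralizedQuadrangle (I q) (q : ℕ) ((q : ℕ) ^ 2)) ∧
      Tendsto (fun q => Fintype.card (P q)) atTop atTop ∧
      (fun q => negSquareEnergy (collinearityGraph (I q)) /
          posSquareEnergy (collinearityGraph (I q)))
        =Θ[atTop] (fun q => (Fintype.card (P q) : ℝ) ^ (1 / 4 : ℝ))) ∧
    -- the collinearity graph of any finite generalised quadrangle of order `(s, t)` is strongly
    -- regular, with parameters and spectrum determined by `(s, t)`
    (∀ (P : Type u) (L : Type v) [Fintype P] (I : P → L → Prop)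
        [DecidableRel (collinearityGraph I).Adj] (s t : ℕ),
      IsGeneralizedQuadrangle I s t →
      (collinearityGraph I).IsSRGWith
          ((s + 1) * (s * t + 1)) (s * (t + 1)) (s - 1) (t + 1) ∧
      ∃ f g : ℕ,
        (f : ℝ) = (s * (s + 1) * t * (t + 1) : ℝ) / (s + t) ∧
        (g : ℝ) = (s ^ 2 * (s * t + 1) : ℝ) / (s + t) ∧
        adjSpectrum (collinearityGraph I) =
          {(s * (t + 1) : ℝ)} + Multiset.replicate f ((s : ℝ) - 1) +
            Multiset.replicate g (-(t : ℝ) - 1)) :=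
  ⟨exists_generalizedQuadrangle_family_isTheta, fun _ _ _ _ _ _ _ h =>
    ⟨h.isSRGWith, h.exists_adjSpectrum_eq⟩⟩
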